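/- Let $V$ be a complex vector space of finite dimension $n$. A reflection is an element $t\in GL(V)$ whose fixed space $\{v\in V : t(v)=v\}$ has dimension $n-1$. A complex reflection group on $V$ is a finite subgroup $W\subseteq GL(V)$ generated by reflections; its rank is $n=\dim V$. It is irreducible if it cannot be expressed as a direct product $W_1\times W_2$ of complex reflection groups $W_1\subseteq GL(V_1)$, $W_2\subseteq GL(V_2)$ acting on $V=V_1\oplus V_2$ unless $V_1=0$ or $V_2=0$. The group $W$ acts on $V^*$ by $w\cdot f=f\circ w^{-1}$, hence on $V\oplus V^*$ and, by algebra automorphisms, on the exterior algebra $\wedge(V\oplus V^*)$. Let $$DR_W := \wedge(V\oplus V^*)\,/\,\langle \wedge(V\oplus V^*)^W_+\rangle$$ be the quotient by the two-sided ideal generated by the $W$-invariant elements with vanishing constant term. Corollary 4.4. If $W$ is an irreducible complex reflection group of rank $n$, and $W$ is not the trivial group in the case $n=1$, then $$\dim_{\mathbb C} DR_W = \binom{2n+1}{n}.$$ -/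

import Mathlib

open Module

/-- A linear automorphism `t` of `V` is a reflection if its fixed space
`V^t = {v | t v = v}` has dimension `dim V - 1`. -/
def IsComplexReflection {V : Type*} [AddCommGroup V] [Module ℂ V] (t : V ≃ₗ[ℂ] V) : Prop :=
  finrank ℂ (LinearMap.fixedSubmodule (t : V →ₗ[ℂ] V)) + 1 = finrank ℂ V

/-- A complex reflection group: a finite subgroup of `GL(V)` generated by reflections. -/
def IsComplexReflectionGroup {V : Type*} [AddCommGroup V] [Module ℂ V]
    (W : Subgroup (V ≃ₗ[ℂ] V)) : Prop :=
  Finite W ∧ ∃ S : Set (V ≃ₗ[ℂ] V), (∀ t ∈ S, IsComplexReflection t) ∧ Subgroup.closure S = W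

/-- `W` is the direct product of `W₁ ≤ GL(V₁)` and `W₂ ≤ GL(V₂)` acting on `V`
(to be used when `V = V₁ ⊕ V₂`): its elements are exactly the `w₁ ⊕ w₂` with `wᵢ ∈ Wᵢ`. -/
def IsProductAction {V : Type*} [AddCommGroup V] [Module ℂ V] (W : Subgroup (V ≃ₗ[ℂ] V))
    {V₁ V₂ : Submodule ℂ V} (W₁ : Subgroup (V₁ ≃ₗ[ℂ] V₁)) (W₂ : Subgroup (V₂ ≃ₗ[ℂ] V₂)) : Prop :=
  ∀ g : V ≃ₗ[ℂ] V, g ∈ W ↔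
    ∃ w₁ ∈ W₁, ∃ w₂ ∈ W₂, (∀ x : V₁, g x = (w₁ x : V)) ∧ (∀ x : V₂, g x = (w₂ x : V))

/-- An irreducible complex reflection group: one that is not a direct product of two reflection
groups acting on `V = V₁ ⊕ V₂` unless `V₁ = 0` or `V₂ = 0`. -/
def IsIrreducibleReflectionGroup {V : Type*} [AddCommGroup V] [Module ℂ V]
    (W : Subgroup (V ≃ₗ[ℂ] V)) : Prop :=
  IsComplexReflectionGroup W ∧
    ∀ (V₁ V₂ : Submodule ℂ V), IsCompl V₁ V₂ →
      ∀ (W₁ : Subgroup (V₁ ≃ₗ[ℂ] V₁)) (W₂ : Subgroup (V₂ ≃ₗ[ℂ] V₂)),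
        IsComplexReflectionGroup W₁ → IsComplexReflectionGroup W₂ → IsProductAction W W₁ W₂ →
          V₁ = ⊥ ∨ V₂ = ⊥

/-- The exterior algebra `∧(V ⊕ V*)`. -/
abbrev DoubleExterior (V : Type*) [AddCommGroup V] [Module ℂ V] : Type _ :=
  ExteriorAlgebra ℂ (V × Dual ℂ V)

/-- The action of `w ∈ GL(V)` on `V ⊕ V*`: `w` on `V`, and `f ↦ f ∘ w⁻¹` on `V*`. -/
def doubleAction {V : Type*} [AddCommGroup V] [Module ℂ V] (w : V ≃ₗ[ℂ] V) :
    (V × Dual ℂ V) →ₗ[ℂ] (V × Dual ℂ V) :=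
  LinearMap.prodMap (w : V →ₗ[ℂ] V) (LinearMap.dualMap (w.symm : V →ₗ[ℂ] V))

/-- The `W`-invariant elements of `∧(V ⊕ V*)` with vanishing constant term, where `w ∈ W` acts on
`∧(V ⊕ V*)` by the algebra automorphism extending its action on `V ⊕ V*`. -/
def positiveInvariants {V : Type*} [AddCommGroup V] [Module ℂ V] (W : Subgroup (V ≃ₗ[ℂ] V)) :
    Set (DoubleExterior V) :=
  {x | (∀ w ∈ W, ExteriorAlgebra.map (doubleAction w) x = x) ∧
    ExteriorAlgebra.algebraMapInv x = 0}

/-- The fermionic diagonal coinvariant ring `DR_W`: the quotient of `∧(V ⊕ V*)` by the two-sided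
ideal generated by the `W`-invariants with vanishing constant term. -/
abbrev FermionicDR {V : Type*} [AddCommGroup V] [Module ℂ V] (W : Subgroup (V ≃ₗ[ℂ] V)) : Type _ :=
  DoubleExterior V ⧸ (TwoSidedIdeal.span (positiveInvariants W)).asIdeal

/-! ### Reflections, invariant subspaces and irreducibility -/

section ReflectionGroups

variable {V : Type*} [AddCommGroup V] [Module ℂ V]

/-! The defining ideal is principal, generated by the canonical element `δ = ∑ i, b i ∧ b i*` of
`∧²(V ⊕ V*)`, and the dimension is then a hard Lefschetz count.

A reflection `x ↦ x + f x • a` of finite order has `f a ≠ 0`. An element fixed by it is killed by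
the derivation `glOp a f` of the rank one matrix `a ⊗ f` (`glOp_apply_eq_zero_of_map_eq`).
Commutators of these derivations, together with irreducibility, show that a `W`-invariant is killed
by all of `gl(V)` (`glOp_apply_eq_zero_of_invariant`).

Let `L` be multiplication by `δ` and `Λ` the dual contraction. They satisfy the `sl₂` relation `ΛL -
LΛ = n - k` in degree `k`. On a `gl(V)`-invariant of degree `k` the operator `LΛ` is the scalar
`(k/2)(n + 1 - k/2)`, which is nonzero for `0 < k ≤ 2n`; hence the invariant is a multiple of `δ`
(`exists_canonicalElement_mul_eq`). As `δ` is itself invariant and central, the ideal is the range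
of `L` (`mem_span_positiveInvariants_iff`).

Finally `L` is injective on degrees below `n` and maps degree `k` onto degree `k + 2` for `k ≥ n`.
The cokernel therefore has the dimension of degrees `n` and `n + 1` together
(`finrank_quotient_range_of_lowering`), namely `C(2n, n) + C(2n, n + 1) = C(2n + 1, n)`. -/

theorem IsComplexReflection.exists_eq_add_smul [FiniteDimensional ℂ V] {t : V ≃ₗ[ℂ] V}
    (ht : IsComplexReflection t) :
    ∃ (a : V) (f : Dual ℂ V), a ≠ 0 ∧ f ≠ 0 ∧ ∀ x, t x = x + f x • a := by
  have hker : LinearMap.ker ((t : V →ₗ[ℂ] V) - LinearMap.id) =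
      LinearMap.fixedSubmodule (t : V →ₗ[ℂ] V) := (LinearMap.fixedSubmodule_eq_ker _).symm
  have hr := LinearMap.finrank_range_add_finrank_ker ((t : V →ₗ[ℂ] V) - LinearMap.id)
  rw [hker] at hr
  unfold IsComplexReflection at ht
  obtain ⟨⟨a, ha⟩, ha0, hspan⟩ := finrank_eq_one_iff'.1 (by omega :
    finrank ℂ (LinearMap.range ((t : V →ₗ[ℂ] V) - LinearMap.id)) = 1)
  have ha1 : a ≠ 0 := fun h => ha0 (Subtype.ext h)
  obtain ⟨g, hg⟩ := Module.Projective.exists_dual_eq_one ℂ ha1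
  have key : ∀ x, t x = x + (g ∘ₗ ((t : V →ₗ[ℂ] V) - LinearMap.id)) x • a := by
    intro x
    obtain ⟨c, hc⟩ := hspan
      ⟨_, LinearMap.mem_range_self ((t : V →ₗ[ℂ] V) - LinearMap.id) x⟩
    have hc' : c • a = t x - x := by simpa using congrArg Subtype.val hc
    have : g (t x - x) = c := by rw [← hc']; simp [hg]
    simp only [LinearMap.comp_apply, LinearMap.sub_apply,
      LinearEquiv.coe_coe, LinearMap.id_apply, this, hc']
    abel
  refine ⟨a, _, ha1, ?_, key⟩
  intro h
  obtain ⟨y, hy⟩ := ha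
  apply ha1
  have := key y
  rw [h] at this
  rw [← hy]
  simpa [sub_eq_zero] using this

theorem isComplexReflection_of_eq_add_smul [FiniteDimensional ℂ V] {t : V ≃ₗ[ℂ] V}
    {a : V} {f : Dual ℂ V} (ha : a ≠ 0) (hf : f ≠ 0) (h : ∀ x, t x = x + f x • a) :
    IsComplexReflection t := by
  have : LinearMap.fixedSubmodule (t : V →ₗ[ℂ] V) = LinearMap.ker f := by
    ext x
    simp [LinearMap.mem_fixedSubmodule_iff, h, ha]
  unfold IsComplexReflection
  rw [this]
  exact Module.Dual.finrank_ker_add_one_of_ne_zero hf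

/-- If `f a = 0`, then `t` is a transvection and `t ^ k` adds `k * f x • a`, so `t` has infinite
order in characteristic zero. -/
theorem apply_ne_zero_of_pow_eq_one {t : V ≃ₗ[ℂ] V} {a : V} {f : Dual ℂ V} (ha : a ≠ 0)
    (hf : f ≠ 0) (h : ∀ x, t x = x + f x • a) {m : ℕ} (hm : m ≠ 0) (ht : t ^ m = 1) :
    f a ≠ 0 := by
  intro h0
  have key : ∀ (k : ℕ) (x : V), (t ^ k) x = x + ((k : ℂ) * f x) • a := by
    intro k
    induction k with
    | zero => intro x; simp
    | succ k ih =>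
      intro x
      rw [pow_succ, LinearEquiv.mul_apply, ih, h]
      simp only [map_add, map_smul, h0, smul_eq_mul, mul_zero, add_zero, Nat.cast_add,
        Nat.cast_one]
      module
  apply hf
  ext x
  have := key m x
  rw [ht] at this
  simpa [ha, hm] using this

/-- The subgroup of `GL(U)` of the restrictions to `U` of elements of `W`. -/
def restrictSubgroup (W : Subgroup (V ≃ₗ[ℂ] V)) (U : Submodule ℂ V) :
    Subgroup (U ≃ₗ[ℂ] U) where
  carrier := {u | ∃ h ∈ W, ∀ x : U, h x = u x}
  mul_mem' := by
    rintro u v ⟨g, hg, hu⟩ ⟨h, hh, hv⟩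
    exact ⟨g * h, W.mul_mem hg hh, fun x => by
      rw [LinearEquiv.mul_apply, LinearEquiv.mul_apply, hv, hu]⟩
  one_mem' := ⟨1, W.one_mem, fun x => rfl⟩
  inv_mem' := by
    rintro u ⟨g, hg, hu⟩
    refine ⟨g⁻¹, W.inv_mem hg, fun x => ?_⟩
    have : g (u⁻¹ x : U) = x := by
      rw [hu, ← LinearEquiv.mul_apply, mul_inv_cancel, LinearEquiv.coe_one, id]
    rw [← this, ← LinearEquiv.mul_apply, inv_mul_cancel, LinearEquiv.coe_one, id]

theorem mem_restrictSubgroup {W : Subgroup (V ≃ₗ[ℂ] V)} {U : Submodule ℂ V} {u : U ≃ₗ[ℂ] U} :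
    u ∈ restrictSubgroup W U ↔ ∃ h ∈ W, ∀ x : U, h x = u x := Iff.rfl

theorem finite_restrictSubgroup {W : Subgroup (V ≃ₗ[ℂ] V)} [Finite W] (U : Submodule ℂ V) :
    Finite (restrictSubgroup W U) := by
  choose φ hφ hφ' using fun u : restrictSubgroup W U => mem_restrictSubgroup.1 u.2
  refine Finite.of_injective (fun u => (⟨φ u, hφ u⟩ : W)) ?_
  intro u v huv
  have : φ u = φ v := congrArg Subtype.val huv
  apply Subtype.ext
  ext x
  rw [← hφ', ← hφ', this]

theorem exists_restrict {W : Subgroup (V ≃ₗ[ℂ] V)} {U : Submodule ℂ V}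
    (hU : ∀ w ∈ W, ∀ x ∈ U, w x ∈ U) {w : V ≃ₗ[ℂ] V} (hw : w ∈ W) :
    ∃ u : U ≃ₗ[ℂ] U, ∀ x : U, (u x : V) = w x :=
  ⟨LinearEquiv.ofLinearMap ((w : V →ₗ[ℂ] V).restrict (hU w hw))
    (((w⁻¹ : V ≃ₗ[ℂ] V) : V →ₗ[ℂ] V).restrict (hU _ (W.inv_mem hw)))
    (by ext x; exact w.apply_symm_apply x) (by ext x; exact w.symm_apply_apply x), fun _ => rfl⟩

/-- A generating reflection `x ↦ x + f x • a` restricts to the identity of `U` when `f` vanishes on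
`U`; otherwise invariance forces `a ∈ U`, and the restriction is again a reflection. -/
theorem isComplexReflectionGroup_restrictSubgroup [FiniteDimensional ℂ V]
    {W : Subgroup (V ≃ₗ[ℂ] V)} (hW : IsComplexReflectionGroup W) {U : Submodule ℂ V}
    (hU : ∀ w ∈ W, ∀ x ∈ U, w x ∈ U) :
    IsComplexReflectionGroup (restrictSubgroup W U) := by
  obtain ⟨hfin, S, hS, rfl⟩ := hW
  refine ⟨finite_restrictSubgroup U,
    {u | IsComplexReflection u ∧ u ∈ restrictSubgroup (Subgroup.closure S) U},
    fun _ h => h.1, le_antisymm ((Subgroup.closure_le _).2 fun _ h => h.2) ?_⟩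
  set C := Subgroup.closure
    {u | IsComplexReflection u ∧ u ∈ restrictSubgroup (Subgroup.closure S) U} with hC
  have key : ∀ h ∈ Subgroup.closure S, ∃ u ∈ C, ∀ x : U, h x = u x := by
    intro h hh
    induction hh using Subgroup.closure_induction with
    | mem t ht =>
      obtain ⟨u, hu⟩ := exists_restrict hU (Subgroup.subset_closure ht)
      refine ⟨u, ?_, fun x => (hu x).symm⟩
      obtain ⟨a, f, ha, hf, htf⟩ := (hS t ht).exists_eq_add_smul
      by_cases hfU : ∀ x : U, f x = 0
      · have : u = 1 := by
          ext x
          rw [hu, htf, hfU]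
          simp
        rw [this]
        exact C.one_mem
      · push Not at hfU
        obtain ⟨x, hx⟩ := hfU
        have haU : a ∈ U := by
          have h1 := U.sub_mem (u x).2 x.2
          rw [hu, htf, add_sub_cancel_left] at h1
          exact (U.smul_mem_iff hx).1 h1
        refine Subgroup.subset_closure ⟨?_, t, Subgroup.subset_closure ht, fun x => (hu x).symm⟩
        refine isComplexReflection_of_eq_add_smul (a := ⟨a, haU⟩) (f := f ∘ₗ U.subtype) ?_ ?_ ?_
        · exact fun h => ha (congrArg Subtype.val h)
        · exact fun h => hx (LinearMap.congr_fun h x)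
        · intro y
          apply Subtype.ext
          rw [hu, htf]
          rfl
    | one => exact ⟨1, C.one_mem, fun _ => rfl⟩
    | mul g h _ _ ihg ihh =>
      obtain ⟨u, hu, hgu⟩ := ihg
      obtain ⟨v, hv, hhv⟩ := ihh
      exact ⟨u * v, C.mul_mem hu hv, fun x => by
        rw [LinearEquiv.mul_apply, LinearEquiv.mul_apply, hhv, hgu]⟩
    | inv g _ ihg =>
      obtain ⟨u, hu, hgu⟩ := ihg
      refine ⟨u⁻¹, C.inv_mem hu, fun x => ?_⟩
      have : g (u⁻¹ x : U) = x := by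
        rw [hgu, ← LinearEquiv.mul_apply, mul_inv_cancel, LinearEquiv.coe_one, id]
      rw [← this, ← LinearEquiv.mul_apply, inv_mul_cancel, LinearEquiv.coe_one, id]
  rintro u ⟨h, hh, hu⟩
  obtain ⟨v, hv, hhv⟩ := key h hh
  have : u = v := by
    ext x
    rw [← hu, ← hhv]
  exact this ▸ hv

/-- In a group generated by reflections that preserves `U₁ ⊕ U₂ = V`, each element restricted to
`U₁` and extended by the identity of `U₂` belongs to the group. -/
theorem exists_mem_eq_on_and_fix [FiniteDimensional ℂ V] {S : Set (V ≃ₗ[ℂ] V)}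
    (hS : ∀ t ∈ S, IsComplexReflection t) {U₁ U₂ : Submodule ℂ V} (hdisj : Disjoint U₁ U₂)
    (h₁ : ∀ w ∈ Subgroup.closure S, ∀ x ∈ U₁, w x ∈ U₁)
    (h₂ : ∀ w ∈ Subgroup.closure S, ∀ x ∈ U₂, w x ∈ U₂)
    {h : V ≃ₗ[ℂ] V} (hh : h ∈ Subgroup.closure S) :
    ∃ k ∈ Subgroup.closure S, (∀ x ∈ U₁, k x = h x) ∧ ∀ x ∈ U₂, k x = x := by
  induction hh using Subgroup.closure_induction with
  | mem t ht =>
    obtain ⟨a, f, ha, hf, htf⟩ := (hS t ht).exists_eq_add_smul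
    -- A reflection acts trivially on any invariant subspace that misses its root `a`. As `a` lies
    -- in at most one of `U₁`, `U₂`, each reflection moves at most one summand.
    have aux : ∀ U : Submodule ℂ V, (∀ w ∈ Subgroup.closure S, ∀ x ∈ U, w x ∈ U) →
        a ∉ U → ∀ x ∈ U, t x = x := by
      intro U hU haU x hx
      by_cases hfx : f x = 0
      · rw [htf, hfx]; simp
      · have h1 := U.sub_mem (hU t (Subgroup.subset_closure ht) x hx) hx
        rw [htf, add_sub_cancel_left] at h1
        exact absurd ((U.smul_mem_iff hfx).1 h1) haU
    by_cases haU : a ∈ U₂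
    · have haU₁ : a ∉ U₁ := fun h => ha (Submodule.disjoint_def.1 hdisj a h haU)
      exact ⟨1, Subgroup.one_mem _, fun x hx => (aux U₁ h₁ haU₁ x hx).symm, fun _ _ => rfl⟩
    · exact ⟨t, Subgroup.subset_closure ht, fun _ _ => rfl, aux U₂ h₂ haU⟩
  | one => exact ⟨1, Subgroup.one_mem _, fun _ _ => rfl, fun _ _ => rfl⟩
  | mul g h hg hh ihg ihh =>
    obtain ⟨u, hu, hu1, hu2⟩ := ihg
    obtain ⟨v, hv, hv1, hv2⟩ := ihh
    refine ⟨u * v, Subgroup.mul_mem _ hu hv, fun x hx => ?_, fun x hx => ?_⟩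
    · rw [LinearEquiv.mul_apply, LinearEquiv.mul_apply, hv1 x hx, hu1 _ (h₁ h hh x hx)]
    · rw [LinearEquiv.mul_apply, hv2 x hx, hu2 x hx]
  | inv g hg ihg =>
    obtain ⟨u, hu, hu1, hu2⟩ := ihg
    refine ⟨u⁻¹, Subgroup.inv_mem _ hu, fun x hx => ?_, fun x hx => ?_⟩
    · apply u.injective
      rw [hu1 _ (h₁ _ (Subgroup.inv_mem _ hg) x hx)]
      exact (u.apply_symm_apply x).trans (g.apply_symm_apply x).symm
    · apply u.injective
      rw [hu2 x hx]
      exact u.apply_symm_apply x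

/-- Maschke's argument: the average `q` of the conjugates of a projection onto `U` is an equivariant
projection, and its kernel is the complement. -/
theorem exists_invariant_isCompl (W : Subgroup (V ≃ₗ[ℂ] V)) [Finite W] {U : Submodule ℂ V}
    (hU : ∀ w ∈ W, ∀ x ∈ U, w x ∈ U) :
    ∃ U' : Submodule ℂ V, IsCompl U U' ∧ ∀ w ∈ W, ∀ x ∈ U', w x ∈ U' := by
  classical
  have := Fintype.ofFinite W
  obtain ⟨p, hp⟩ := U.subtype.exists_leftInverse_of_injective (by simp)
  have hp' : ∀ x : U, p x = x := LinearMap.congr_fun hp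
  let s : V →ₗ[ℂ] V := ∑ w : W, ((w : V ≃ₗ[ℂ] V) : V →ₗ[ℂ] V) ∘ₗ U.subtype ∘ₗ p ∘ₗ
    ((w⁻¹ : W) : V ≃ₗ[ℂ] V)
  have hs : ∀ x, s x = ∑ w : W, (w : V ≃ₗ[ℂ] V) (p (((w⁻¹ : W) : V ≃ₗ[ℂ] V) x)) := by
    intro x
    simp [s, LinearMap.sum_apply]
  have hsU : ∀ x, s x ∈ U := fun x => by
    rw [hs]
    exact U.sum_mem fun w _ => hU _ w.2 _ (p _).2
  have hsid : ∀ x ∈ U, s x = (Fintype.card W : ℂ) • x := by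
    intro x hx
    rw [hs, Finset.sum_congr rfl (g := fun _ => x), Finset.sum_const, Finset.card_univ,
      Nat.cast_smul_eq_nsmul]
    intro w _
    have h1 : ((w⁻¹ : W) : V ≃ₗ[ℂ] V) x ∈ U := hU _ (w⁻¹).2 x hx
    have h2 := congrArg (Subtype.val) (hp' ⟨_, h1⟩)
    rw [h2]
    exact (w : V ≃ₗ[ℂ] V).apply_symm_apply x
  have hscomm : ∀ (g : W) x, s ((g : V ≃ₗ[ℂ] V) x) = (g : V ≃ₗ[ℂ] V) (s x) := by
    intro g x
    rw [hs, hs, map_sum]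
    refine Fintype.sum_equiv (Equiv.mulLeft g⁻¹) _ _ fun w => ?_
    have e1 : ((Equiv.mulLeft g⁻¹ w)⁻¹ : W) = w⁻¹ * g := by simp
    rw [e1, Subgroup.coe_mul, LinearEquiv.mul_apply, ← LinearEquiv.mul_apply, ← Subgroup.coe_mul]
    simp
  have hc : (Fintype.card W : ℂ) ≠ 0 := by simp
  let q : V →ₗ[ℂ] U := ((Fintype.card W : ℂ)⁻¹ • s).codRestrict U fun x => U.smul_mem _ (hsU x)
  have hqv : ∀ x, (q x : V) = (Fintype.card W : ℂ)⁻¹ • s x := fun x => rfl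
  have hq : ∀ x : U, q x = x := by
    intro x
    apply Subtype.ext
    rw [hqv, hsid x x.2, inv_smul_smul₀ hc]
  refine ⟨LinearMap.ker q, LinearMap.isCompl_of_proj hq, fun w hw x hx => ?_⟩
  rw [LinearMap.mem_ker] at hx ⊢
  have hx' : s x = 0 := by
    have := congrArg Subtype.val hx
    rw [hqv] at this
    simpa [hc] using this
  apply Subtype.ext
  rw [hqv, hscomm ⟨w, hw⟩ x, hx']
  simp

/-- Passes from indecomposability as a product of reflection groups to irreducibility as a
representation: an invariant subspace and its invariant complement split `W` as the product of its
two restrictions. -/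
theorem IsIrreducibleReflectionGroup.eq_bot_or_eq_top [FiniteDimensional ℂ V]
    {W : Subgroup (V ≃ₗ[ℂ] V)} (hW : IsIrreducibleReflectionGroup W) {U : Submodule ℂ V}
    (hU : ∀ w ∈ W, ∀ x ∈ U, w x ∈ U) : U = ⊥ ∨ U = ⊤ := by
  obtain ⟨hrefl, hirr⟩ := hW
  have := hrefl.1
  obtain ⟨U', hc, hU'⟩ := exists_invariant_isCompl W hU
  have hprod : IsProductAction W (restrictSubgroup W U) (restrictSubgroup W U') := by
    obtain ⟨-, S, hS, rfl⟩ := hrefl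
    intro g
    constructor
    · intro hg
      obtain ⟨u, hu⟩ := exists_restrict hU hg
      obtain ⟨u', hu'⟩ := exists_restrict hU' hg
      exact ⟨u, ⟨g, hg, fun x => (hu x).symm⟩, u', ⟨g, hg, fun x => (hu' x).symm⟩,
        fun x => (hu x).symm, fun x => (hu' x).symm⟩
    · rintro ⟨u, ⟨h, hh, hu⟩, u', ⟨h', hh', hu'⟩, hg, hg'⟩
      obtain ⟨k, hk, hk1, hk2⟩ := exists_mem_eq_on_and_fix hS hc.disjoint hU hU' hh
      obtain ⟨k', hk', hk1', hk2'⟩ := exists_mem_eq_on_and_fix hS hc.disjoint.symm hU' hU hh'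
      have : g = k * k' := by
        ext x
        obtain ⟨y, hy, z, hz, rfl⟩ := Submodule.mem_sup.1
          (hc.sup_eq_top ▸ Submodule.mem_top : x ∈ U ⊔ U')
        rw [LinearEquiv.mul_apply, map_add, map_add, map_add, hk2' y hy, hk1 y hy, hk1' z hz,
          hk2 _ (hU' _ hh' z hz), hg ⟨y, hy⟩, hg' ⟨z, hz⟩, ← hu ⟨y, hy⟩, ← hu' ⟨z, hz⟩]
      rw [this]
      exact Subgroup.mul_mem _ hk hk'
  rcases hirr U U' hc _ _ (isComplexReflectionGroup_restrictSubgroup hrefl hU)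
    (isComplexReflectionGroup_restrictSubgroup hrefl hU') hprod with h | h
  · exact Or.inl h
  · right
    have := hc.sup_eq_top
    rwa [h, sup_bot_eq] at this

/-- The trivial group preserves every line, so irreducibility would force dimension one, which `h1`
excludes. -/
theorem IsIrreducibleReflectionGroup.ne_bot [FiniteDimensional ℂ V]
    {W : Subgroup (V ≃ₗ[ℂ] V)} (hW : IsIrreducibleReflectionGroup W)
    (h0 : finrank ℂ V ≠ 0) (h1 : finrank ℂ V = 1 → W ≠ ⊥) : W ≠ ⊥ := by
  intro hbot
  have : Nontrivial V := Module.nontrivial_of_finrank_pos (R := ℂ) (by omega)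
  obtain ⟨v, hv⟩ := exists_ne (0 : V)
  rcases hW.eq_bot_or_eq_top (U := Submodule.span ℂ {v}) (by
    intro w hw x hx
    rw [hbot, Subgroup.mem_bot] at hw
    rw [hw]
    exact hx) with h | h
  · exact hv (Submodule.span_singleton_eq_bot.1 h)
  · refine h1 ?_ hbot
    rw [← finrank_top ℂ V, ← h]
    exact finrank_span_singleton hv

end ReflectionGroups

/-! ### Creation and annihilation operators on an exterior algebra -/

section CanonicalAnticommutation

variable {R E : Type*} [CommRing R] [AddCommGroup E] [Module R E]

/-- Left exterior multiplication by a vector, as an operator on the exterior algebra. -/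
noncomputable def wedgeOp : E →ₗ[R] Module.End R (ExteriorAlgebra R E) :=
  LinearMap.mul R (ExteriorAlgebra R E) ∘ₗ ExteriorAlgebra.ι R

/-- Contraction with a covector, as an operator on the exterior algebra. -/
noncomputable def contractOp : Dual R E →ₗ[R] Module.End R (ExteriorAlgebra R E) :=
  CliffordAlgebra.contractLeft

theorem wedgeOp_apply (e : E) (z : ExteriorAlgebra R E) :
    wedgeOp e z = ExteriorAlgebra.ι R e * z := rfl

theorem contractOp_ι_mul (d : Dual R E) (e : E) (z : ExteriorAlgebra R E) :
    contractOp d (ExteriorAlgebra.ι R e * z) = d e • z - ExteriorAlgebra.ι R e * contractOp d z :=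
  CliffordAlgebra.contractLeft_ι_mul d e z

theorem contractOp_one (d : Dual R E) : contractOp d (1 : ExteriorAlgebra R E) = 0 :=
  CliffordAlgebra.contractLeft_one _ d

theorem wedgeOp_mul_wedgeOp (e e' : E) :
    (wedgeOp e * wedgeOp e' : Module.End R (ExteriorAlgebra R E)) = -(wedgeOp e' * wedgeOp e) := by
  refine LinearMap.ext fun z => ?_
  have h := eq_neg_of_add_eq_zero_left (ExteriorAlgebra.ι_add_mul_swap (R := R) e e')
  simp only [Module.End.mul_apply, wedgeOp_apply, LinearMap.neg_apply, ← mul_assoc, h, neg_mul]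

theorem contractOp_mul_contractOp (d d' : Dual R E) :
    (contractOp d * contractOp d' : Module.End R (ExteriorAlgebra R E)) =
      -(contractOp d' * contractOp d) := by
  refine LinearMap.ext fun z => ?_
  exact CliffordAlgebra.contractLeft_comm _ _ z

theorem contractOp_mul_wedgeOp (d : Dual R E) (e : E) :
    (contractOp d * wedgeOp e : Module.End R (ExteriorAlgebra R E)) =
      d e • 1 - wedgeOp e * contractOp d := by
  refine LinearMap.ext fun z => ?_
  exact contractOp_ι_mul d e z

theorem wedgeOp_mul_self (e : E) :
    (wedgeOp e * wedgeOp e : Module.End R (ExteriorAlgebra R E)) = 0 := by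
  refine LinearMap.ext fun z => ?_
  rw [Module.End.mul_apply, wedgeOp_apply, wedgeOp_apply, ← mul_assoc,
    ExteriorAlgebra.ι_sq_zero, zero_mul, LinearMap.zero_apply]

/-- The derivation of the exterior algebra extending the rank one endomorphism `d ⊗ e` of `E`. -/
noncomputable def rankOneOp (e : E) (d : Dual R E) : Module.End R (ExteriorAlgebra R E) :=
  wedgeOp e * contractOp d

theorem rankOneOp_mul_rankOneOp (e e' : E) (d d' : Dual R E) :
    rankOneOp e d * rankOneOp e' d' = d e' • rankOneOp e d' -
      wedgeOp e * wedgeOp e' * (contractOp d * contractOp d') := by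
  have := contractOp_mul_wedgeOp d e'
  calc rankOneOp e d * rankOneOp e' d'
      = wedgeOp e * (contractOp d * wedgeOp e') * contractOp d' := by
        simp only [rankOneOp, mul_assoc]
    _ = _ := by
        rw [this, mul_sub, sub_mul]
        simp only [rankOneOp, mul_assoc, mul_smul_comm, smul_mul_assoc, mul_one]

theorem rankOneOp_mul_sub (e e' : E) (d d' : Dual R E) :
    rankOneOp e d * rankOneOp e' d' - rankOneOp e' d' * rankOneOp e d =
      d e' • rankOneOp e d' - d' e • rankOneOp e' d := by
  have hm : wedgeOp (R := R) e * wedgeOp e' * (contractOp d * contractOp d') =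
      wedgeOp e' * wedgeOp e * (contractOp d' * contractOp d) := by
    refine LinearMap.ext fun z => ?_
    rw [wedgeOp_mul_wedgeOp e, contractOp_mul_contractOp d]
    simp only [Module.End.mul_apply, LinearMap.neg_apply, map_neg, neg_neg]
  rw [rankOneOp_mul_rankOneOp, rankOneOp_mul_rankOneOp, hm]
  abel

theorem rankOneOp_mul_self (e : E) (d : Dual R E) :
    rankOneOp e d * rankOneOp e d = d e • rankOneOp e d := by
  rw [rankOneOp_mul_rankOneOp, wedgeOp_mul_self, zero_mul, sub_zero]

/-- The expansion of the induced automorphism stops at the linear term, since every further term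
contains `e ∧ e = 0`. -/
theorem map_id_add_smulRight (e : E) (d : Dual R E) (z : ExteriorAlgebra R E) :
    ExteriorAlgebra.map (LinearMap.id + d.smulRight e) z = z + rankOneOp e d z := by
  induction z using CliffordAlgebra.left_induction with
  | algebraMap r =>
    rw [AlgHom.commutes, Algebra.algebraMap_eq_smul_one, map_smul]
    simp [rankOneOp, contractOp_one]
  | add x y hx hy => rw [map_add, hx, hy, map_add]; abel
  | ι_mul z v hz =>
    have h1 : ExteriorAlgebra.map (LinearMap.id + d.smulRight e) (ExteriorAlgebra.ι R v) =
        ExteriorAlgebra.ι R v + d v • ExteriorAlgebra.ι R e := by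
      rw [ExteriorAlgebra.map_apply_ι]
      simp
    have h2 := eq_neg_of_add_eq_zero_left (ExteriorAlgebra.ι_add_mul_swap (R := R) e v)
    change ExteriorAlgebra.map (LinearMap.id + d.smulRight e) (ExteriorAlgebra.ι R v * z) =
      ExteriorAlgebra.ι R v * z + rankOneOp e d (ExteriorAlgebra.ι R v * z)
    rw [map_mul, hz, h1]
    simp only [rankOneOp, Module.End.mul_apply, contractOp_ι_mul, wedgeOp_apply, mul_add, add_mul,
      mul_sub, smul_mul_assoc, mul_smul_comm]
    rw [← mul_assoc (ExteriorAlgebra.ι R e) (ExteriorAlgebra.ι R e), ExteriorAlgebra.ι_sq_zero,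
      ← mul_assoc (ExteriorAlgebra.ι R e) (ExteriorAlgebra.ι R v), h2, neg_mul, mul_assoc]
    simp only [zero_mul, smul_zero]
    abel

end CanonicalAnticommutation

/-! ### Invariants of `W` are annihilated by `gl(V)` -/

section InvariantDerivations

variable {V : Type*} [AddCommGroup V] [Module ℂ V]

/-- A covector on `V`, regarded as a covector on `V ⊕ V*`. -/
def dualInl : Dual ℂ V →ₗ[ℂ] Dual ℂ (V × Dual ℂ V) :=
  (LinearMap.fst ℂ V (Dual ℂ V)).dualMap

/-- A vector of `V`, regarded as a covector on `V ⊕ V*` by evaluation. -/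
def dualInr : V →ₗ[ℂ] Dual ℂ (V × Dual ℂ V) :=
  (LinearMap.snd ℂ V (Dual ℂ V)).dualMap ∘ₗ Dual.eval ℂ V

@[simp] theorem dualInl_apply (f : Dual ℂ V) (e : V × Dual ℂ V) : dualInl f e = f e.1 := rfl

@[simp] theorem dualInr_apply (a : V) (e : V × Dual ℂ V) : dualInr a e = e.2 a := rfl

/-- The derivation of `∧(V ⊕ V*)` through which `x ↦ f x • a` in `gl(V)` acts. -/
noncomputable def glOp (a : V) (f : Dual ℂ V) : Module.End ℂ (DoubleExterior V) :=
  rankOneOp (a, 0) (dualInl f) - rankOneOp (0, f) (dualInr a)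

theorem glOp_add_left (a b : V) (f : Dual ℂ V) : glOp (a + b) f = glOp a f + glOp b f := by
  have : ((a + b, 0) : V × Dual ℂ V) = (a, 0) + (b, 0) := by simp
  simp only [glOp, rankOneOp, this, map_add, add_mul, mul_add]
  abel

theorem glOp_smul_left (c : ℂ) (a : V) (f : Dual ℂ V) : glOp (c • a) f = c • glOp a f := by
  have : ((c • a, 0) : V × Dual ℂ V) = c • (a, 0) := by simp
  simp only [glOp, rankOneOp, this, map_smul, smul_mul_assoc, mul_smul_comm, smul_sub]

theorem glOp_add_right (a : V) (f g : Dual ℂ V) : glOp a (f + g) = glOp a f + glOp a g := by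
  have : ((0, f + g) : V × Dual ℂ V) = (0, f) + (0, g) := by simp
  simp only [glOp, rankOneOp, this, map_add, add_mul, mul_add]
  abel

theorem glOp_smul_right (c : ℂ) (a : V) (f : Dual ℂ V) : glOp a (c • f) = c • glOp a f := by
  have : ((0, c • f) : V × Dual ℂ V) = c • (0, f) := by simp
  simp only [glOp, rankOneOp, this, map_smul, smul_mul_assoc, mul_smul_comm, smul_sub]

theorem rankOneOp_inl_mul_inr (a b : V) (f g : Dual ℂ V) :
    rankOneOp ((a, 0) : V × Dual ℂ V) (dualInl f) * rankOneOp (0, g) (dualInr b) =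
      rankOneOp (0, g) (dualInr b) * rankOneOp (a, 0) (dualInl f) := by
  rw [← sub_eq_zero, rankOneOp_mul_sub]
  simp

theorem glOp_mul_sub (a b : V) (f g : Dual ℂ V) :
    glOp a f * glOp b g - glOp b g * glOp a f = f b • glOp a g - g a • glOp b f := by
  have h1 := rankOneOp_mul_sub ((a, 0) : V × Dual ℂ V) (b, 0) (dualInl f) (dualInl g)
  have h2 := rankOneOp_mul_sub ((0, f) : V × Dual ℂ V) (0, g) (dualInr a) (dualInr b)
  have h3 := rankOneOp_inl_mul_inr a b f g
  have h4 := rankOneOp_inl_mul_inr b a g f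
  simp only [dualInl_apply, dualInr_apply] at h1 h2
  simp only [glOp, sub_mul, mul_sub, smul_sub, h3, h4]
  linear_combination (norm := module) h1 + h2

theorem glOp_commutator_apply_eq_zero {a b : V} {f g : Dual ℂ V} {w : DoubleExterior V}
    (h₁ : glOp a f w = 0) (h₂ : glOp b g w = 0) : f b • glOp a g w - g a • glOp b f w = 0 := by
  have := LinearMap.congr_fun (glOp_mul_sub a b f g) w
  simpa [Module.End.mul_apply, h₁, h₂] using this.symm

/-- The double commutator with a non-nilpotent rank one operator separates the two terms of the
commutator. -/
theorem smul_glOp_apply_eq_zero {a b : V} {f g : Dual ℂ V} {w : DoubleExterior V}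
    (ha : f a ≠ 0) (h₁ : glOp a f w = 0) (h₂ : glOp b g w = 0) : f b • glOp a g w = 0 := by
  have h3 := glOp_commutator_apply_eq_zero h₁ h₂
  have h4 := LinearMap.congr_fun (glOp_mul_sub a a f g) w
  have h5 := LinearMap.congr_fun (glOp_mul_sub a b f f) w
  simp only [Module.End.mul_apply, LinearMap.sub_apply, LinearMap.smul_apply, h₁, map_zero,
    sub_zero, smul_zero, zero_sub] at h4 h5
  -- The vectors `glOp a g w` and `glOp b f w` are eigenvectors of `glOp a f` with eigenvalues `f a`
  -- and `-f a`. Applying it turns the vanishing difference into a vanishing sum, so both terms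
  -- vanish.
  have h6 := congrArg (glOp a f) h3
  simp only [map_sub, map_smul, map_zero, h4, h5] at h6
  have h7 : f a • (f b • glOp a g w + g a • glOp b f w) = 0 := by
    rw [← h6]; module
  have h8 := (smul_eq_zero.1 h7).resolve_left ha
  have h9 : (2 : ℂ) • (f b • glOp a g w) = 0 := by
    linear_combination (norm := module) h3 + h8
  exact (smul_eq_zero.1 h9).resolve_left two_ne_zero

/-- The inverse of a rank one perturbation of the identity is another one, here with factor `-(1 + f
a)⁻¹`. Hence the action on `V ⊕ V*` is a composite of two maps to which `map_id_add_smulRight`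
applies. -/
theorem doubleAction_eq_of_eq_add_smul {t : V ≃ₗ[ℂ] V} {a : V} {f : Dual ℂ V}
    (h : ∀ x, t x = x + f x • a) (hc : 1 + f a ≠ 0) :
    doubleAction t = (LinearMap.id + (dualInl f).smulRight (a, 0)) ∘ₗ
      (LinearMap.id + (-(1 + f a)⁻¹ • dualInr a).smulRight (0, f)) := by
  have hs : ∀ x, t.symm x = x - ((1 + f a)⁻¹ * f x) • a := by
    intro x
    rw [LinearEquiv.symm_apply_eq, h]
    simp only [map_sub, map_smul, smul_eq_mul]
    have : f x = (1 + f a)⁻¹ * f x + (1 + f a)⁻¹ * f x * f a := by field_simp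
    linear_combination (norm := module) (-1 : ℂ) • (congrArg (fun c : ℂ => c • a) this)
  refine LinearMap.ext fun e => ?_
  obtain ⟨x, φ⟩ := e
  refine Prod.ext ?_ (LinearMap.ext fun y => ?_)
  · simp [doubleAction, h]
  · simp [doubleAction, hs]
    ring

/-- The reflection acts as `(1 + P)(1 + c Q)` with `P`, `Q` commuting, `P² = f a • P` and `Q² = f a
• Q`. Applying `P` and `Q` to the invariance equation gives `f a • P w = QP w = f a • Q w`, and
`glOp a f = P - Q`. -/
theorem glOp_apply_eq_zero_of_map_eq {t : V ≃ₗ[ℂ] V} {a : V} {f : Dual ℂ V}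
    (h : ∀ x, t x = x + f x • a) (ha : f a ≠ 0) {w : DoubleExterior V}
    (hw : ExteriorAlgebra.map (doubleAction t) w = w) : glOp a f w = 0 := by
  have hc : 1 + f a ≠ 0 := by
    intro h0
    have h1 : t a = 0 := by
      rw [h]
      linear_combination (norm := module) (congrArg (fun c : ℂ => c • a) h0)
    have : a = 0 := by simpa using h1
    exact ha (by rw [this, map_zero])
  rw [doubleAction_eq_of_eq_add_smul h hc, ← ExteriorAlgebra.map_comp_map, AlgHom.comp_apply,
    map_id_add_smulRight, map_id_add_smulRight] at hw
  set c : ℂ := -(1 + f a)⁻¹ with hcdef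
  have hP := rankOneOp_mul_self ((a, 0) : V × Dual ℂ V) (dualInl f)
  have hQ := rankOneOp_mul_self ((0, f) : V × Dual ℂ V) (dualInr a)
  have hPQ := rankOneOp_inl_mul_inr a a f f
  have hsm : rankOneOp ((0, f) : V × Dual ℂ V) (c • dualInr a) =
      c • rankOneOp (0, f) (dualInr a) := by
    simp only [rankOneOp, map_smul, mul_smul_comm]
  rw [hsm] at hw
  rw [glOp, LinearMap.sub_apply]
  set P := rankOneOp ((a, 0) : V × Dual ℂ V) (dualInl f)
  set Q := rankOneOp ((0, f) : V × Dual ℂ V) (dualInr a)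
  have hP' : ∀ z, P (P z) = f a • P z := LinearMap.congr_fun hP
  have hQ' : ∀ z, Q (Q z) = f a • Q z := LinearMap.congr_fun hQ
  have hPQ' : ∀ z, P (Q z) = Q (P z) := LinearMap.congr_fun hPQ
  have h0 : c • Q w + P w + c • Q (P w) = 0 := by
    simp only [LinearMap.smul_apply, map_add, map_smul, hPQ'] at hw
    linear_combination (norm := module) hw
  have h1 := congrArg P h0
  have h2 := congrArg Q h0
  simp only [map_add, map_smul, hP', hQ', hPQ', map_zero] at h1 h2
  have hcm : c * (1 + f a) = -1 := by rw [hcdef]; field_simp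
  have e1 : f a • P w = Q (P w) := by
    linear_combination (norm := module) h1 - congrArg (fun s : ℂ => s • Q (P w)) hcm
  have e2 : f a • Q w = Q (P w) := by
    have h3 : c • (f a • Q w - Q (P w)) = 0 := by
      linear_combination (norm := module) h2 - congrArg (fun s : ℂ => s • Q (P w)) hcm
    have hc0 : c ≠ 0 := by rw [hcdef]; exact neg_ne_zero.2 (inv_ne_zero hc)
    exact sub_eq_zero.1 ((smul_eq_zero.1 h3).resolve_left hc0)
  have h4 : f a • (P w - Q w) = 0 := by rw [smul_sub, e1, e2, sub_self]
  exact (smul_eq_zero.1 h4).resolve_left ha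

theorem glOp_apply_eq_zero_of_invariant [FiniteDimensional ℂ V] {W : Subgroup (V ≃ₗ[ℂ] V)}
    (hW : IsIrreducibleReflectionGroup W) (h1 : finrank ℂ V = 1 → W ≠ ⊥) {w : DoubleExterior V}
    (hw : ∀ t ∈ W, ExteriorAlgebra.map (doubleAction t) w = w) (a : V) (f : Dual ℂ V) :
    glOp a f w = 0 := by
  by_cases h0 : finrank ℂ V = 0
  · have := finrank_zero_iff.1 h0
    have h2 := glOp_smul_left 0 a f
    rw [zero_smul, zero_smul] at h2
    rw [Subsingleton.elim a ((0 : ℂ) • a), zero_smul, h2, LinearMap.zero_apply]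
  have hne := hW.ne_bot h0 h1
  have hirr := fun U => hW.eq_bot_or_eq_top (U := U)
  have hrefl := hW.1
  obtain ⟨hfin, S, hS, rfl⟩ := hrefl
  have hdata : ∀ t ∈ S, ∃ (a : V) (f : Dual ℂ V), a ≠ 0 ∧ f ≠ 0 ∧ f a ≠ 0 ∧
      (∀ x, t x = x + f x • a) ∧ glOp a f w = 0 := by
    intro t ht
    obtain ⟨a, f, ha, hf, h⟩ := (hS t ht).exists_eq_add_smul
    have htW := Subgroup.subset_closure ht
    obtain ⟨m, hm, hpow⟩ :=
      (isOfFinOrder_iff_pow_eq_one.1 (isOfFinOrder_of_finite (⟨t, htW⟩ : Subgroup.closure S)))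
    have hfa := apply_ne_zero_of_pow_eq_one ha hf h hm.ne' (congrArg Subtype.val hpow)
    exact ⟨a, f, ha, hf, hfa, h, glOp_apply_eq_zero_of_map_eq h hfa (hw t htW)⟩
  have hstable : ∀ U : Submodule ℂ V, (∀ t ∈ S, ∀ x ∈ U, t x ∈ U) →
      ∀ t ∈ Subgroup.closure S, ∀ x ∈ U, t x ∈ U := by
    intro U hU
    -- Equality of the image with `U`, available by finite dimension, passes to inverses; mere
    -- inclusion would not.
    have key : ∀ t ∈ Subgroup.closure S, U.map (t : V →ₗ[ℂ] V) = U := by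
      intro t ht
      induction ht using Subgroup.closure_induction with
      | mem t ht =>
        exact Submodule.eq_of_le_of_finrank_eq (Submodule.map_le_iff_le_comap.2 (hU t ht))
          (LinearEquiv.finrank_map_eq t U)
      | one => exact Submodule.map_id U
      | mul g h _ _ hg hh =>
        have : ((g * h : V ≃ₗ[ℂ] V) : V →ₗ[ℂ] V) = (g : V →ₗ[ℂ] V) ∘ₗ (h : V →ₗ[ℂ] V) := rfl
        rw [this, Submodule.map_comp, hh, hg]
      | inv g _ hg =>
        have : ((g⁻¹ : V ≃ₗ[ℂ] V) : V →ₗ[ℂ] V) ∘ₗ (g : V →ₗ[ℂ] V) = LinearMap.id :=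
          LinearMap.ext g.symm_apply_apply
        conv_lhs => rw [← hg, ← Submodule.map_comp, this, Submodule.map_id]
    intro t ht x hx
    rw [← key t ht]
    exact ⟨x, hx, rfl⟩
  -- For fixed `f₀`, the vectors `x` with `glOp x f₀ w = 0` form an invariant subspace: a reflection
  -- adds `f x • a` to `x`, and `smul_glOp_apply_eq_zero` keeps this inside. One nonzero member
  -- therefore gives all of `V`.
  have hleft : ∀ f₀ : Dual ℂ V, (∃ a₀ : V, a₀ ≠ 0 ∧ glOp a₀ f₀ w = 0) →
      ∀ x, glOp x f₀ w = 0 := by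
    intro f₀ ⟨a₀, ha₀, h₀⟩
    let U : Submodule ℂ V :=
      { carrier := {x | glOp x f₀ w = 0}
        add_mem' := fun {x y} hx hy => by
          simp only [Set.mem_ofPred_eq] at hx hy ⊢
          rw [glOp_add_left, LinearMap.add_apply, hx, hy, add_zero]
        zero_mem' := by
          have := glOp_smul_left 0 0 f₀
          rw [zero_smul, zero_smul] at this
          simp [this]
        smul_mem' := fun c x hx => by
          simp only [Set.mem_ofPred_eq] at hx ⊢
          rw [glOp_smul_left, LinearMap.smul_apply, hx, smul_zero] }
    have hU : ∀ t ∈ S, ∀ x ∈ U, t x ∈ U := by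
      intro t ht x hx
      obtain ⟨a, f, -, -, hfa, h, hg⟩ := hdata t ht
      rw [h]
      refine U.add_mem hx ?_
      change glOp (f x • a) f₀ w = 0
      rw [glOp_smul_left, LinearMap.smul_apply]
      exact smul_glOp_apply_eq_zero hfa hg hx
    rcases hirr U (hstable U hU) with h | h
    · exact absurd ((Submodule.eq_bot_iff U).1 h a₀ h₀) ha₀
    · intro x
      exact (h ▸ Submodule.mem_top : x ∈ U)
  let F : Submodule ℂ (Dual ℂ V) :=
    { carrier := {f | ∀ x, glOp x f w = 0}
      add_mem' := fun {f g} hf hg x => by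
        rw [glOp_add_right, LinearMap.add_apply, hf, hg, add_zero]
      zero_mem' := fun x => by
        have := glOp_smul_right 0 x 0
        rw [zero_smul, zero_smul] at this
        simp [this]
      smul_mem' := fun c f hf x => by
        rw [glOp_smul_right, LinearMap.smul_apply, hf, smul_zero] }
  have hSF : ∀ t ∈ S, ∃ (a : V) (f : Dual ℂ V), f ≠ 0 ∧ f ∈ F ∧ ∀ x, t x = x + f x • a := by
    intro t ht
    obtain ⟨a, f, ha, hf, hfa, h, hg⟩ := hdata t ht
    exact ⟨a, f, hf, hleft f ⟨a, ha, hg⟩, h⟩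
  suffices hF : F = ⊤ from (hF ▸ Submodule.mem_top : f ∈ F) a
  -- `F` contains the covector of every generating reflection, so the generators fix its common
  -- kernel pointwise. By irreducibility this kernel is `0` or `V`, and `V` is excluded by the
  -- existence of a reflection.
  have hK : ∀ t ∈ S, ∀ x ∈ F.dualCoannihilator, t x ∈ F.dualCoannihilator := by
    intro t ht x hx
    obtain ⟨a, f, -, hf, h⟩ := hSF t ht
    rw [h, (Submodule.mem_dualCoannihilator x).1 hx f hf, zero_smul, add_zero]
    exact hx
  rcases hirr _ (hstable _ hK) with h | h
  · rw [← Subspace.dualCoannihilator_dualAnnihilator_eq (W := F), h,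
      Submodule.dualAnnihilator_bot]
  · exfalso
    obtain ⟨t, ht⟩ : S.Nonempty := by
      rw [Set.nonempty_iff_ne_empty]
      rintro rfl
      exact hne Subgroup.closure_empty
    obtain ⟨a, f, hf0, hf, -⟩ := hSF t ht
    apply hf0
    ext x
    exact (Submodule.mem_dualCoannihilator x).1 (h ▸ Submodule.mem_top) f hf

end InvariantDerivations

/-! ### The `sl₂` and Casimir identities for fermions -/

section FermionOperators

variable {K M ι : Type*} [Field K] [AddCommGroup M] [Module K M] [Fintype ι] [DecidableEq ι]

/-- Creation operators `x i`, `y i` with their annihilation operators `p i`, `q i`, subject to those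
canonical anticommutation relations that the `sl₂` relations rest on. -/
structure IsFermionSystem (x y p q : ι → M →ₗ[K] M) : Prop where
  x_y : ∀ i j z, x i (y j z) = -y j (x i z)
  y_y : ∀ i j z, y i (y j z) = -y j (y i z)
  p_x : ∀ i j z, p i (x j z) = (if i = j then z else 0) - x j (p i z)
  p_y : ∀ i j z, p i (y j z) = -y j (p i z)
  q_x : ∀ i j z, q i (x j z) = -x j (q i z)
  q_y : ∀ i j z, q i (y j z) = (if i = j then z else 0) - y j (q i z)

variable {x y p q : ι → M →ₗ[K] M}

/-- For `i ≠ j` the pairs `q j p j` and `x i y i` commute, being even; the diagonal terms each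
contribute `1 - x i p i - y i q i`. -/
theorem IsFermionSystem.lowering_raising (h : IsFermionSystem x y p q) (z : M) :
    ∑ j, q j (p j (∑ i, x i (y i z))) = ∑ i, x i (y i (∑ j, q j (p j z))) +
      ((Fintype.card ι : K) • z - (∑ i, x i (p i z) + ∑ i, y i (q i z))) := by
  have key : ∀ i j, q j (p j (x i (y i z))) = x i (y i (q j (p j z))) +
      (if j = i then z - (x i (p j z) + y i (q j z)) else 0) := by
    intro i j
    by_cases hij : j = i
    · subst hij
      simp only [h.p_x, h.p_y, h.q_x, h.q_y, map_sub, map_neg, if_true]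
      abel
    · simp only [h.p_x, h.p_y, h.q_x, h.q_y, map_sub, map_neg, if_neg hij, map_zero]
      abel
  simp only [map_sum, key, Finset.sum_add_distrib, Finset.sum_ite_eq, Finset.mem_univ, if_true,
    Finset.sum_sub_distrib, Finset.sum_const, Finset.card_univ, Nat.cast_smul_eq_nsmul]
  rw [Finset.sum_comm]

/-- The Casimir identity for an element on which the operators `x i p j` and `y j q i` agree. -/
theorem IsFermionSystem.raising_lowering (h : IsFermionSystem x y p q) {w : M}
    (hw : ∀ i j, x i (p j w) = y j (q i w)) :
    ∑ i, x i (y i (∑ j, q j (p j w))) = ((Fintype.card ι : K) + 1) • ∑ i, y i (q i w) -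
      ∑ j, y j (q j (∑ i, y i (q i w))) := by
  have key : ∀ i j, x i (y i (q j (p j w))) = y i (q i w) - y j (q j (y i (q i w))) +
      (if j = i then y j (q i w) else 0) := by
    intro i j
    -- Moving `x i` past two odd operators brings it next to `p j w`, where `hw` trades `x i p j`
    -- for `y j q i`.
    have e1 : x i (y i (q j (p j w))) = y i (q j (x i (p j w))) := by
      rw [h.x_y, h.q_x, map_neg]
    have e2 : y i (y j (q j (q i w))) = -y j (y i (q j (q i w))) := h.y_y _ _ _
    rw [e1, hw, h.q_y, h.q_y, map_sub, e2, if_pos rfl, map_sub]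
    by_cases hij : j = i
    · simp only [if_pos hij]; abel
    · simp only [if_neg hij, map_zero]; abel
  simp only [map_sum, key, Finset.sum_add_distrib, Finset.sum_sub_distrib, Finset.sum_ite_eq',
    Finset.mem_univ, if_true, Finset.sum_const, Finset.card_univ, add_smul, one_smul,
    Nat.cast_smul_eq_nsmul, Finset.smul_sum]
  rw [Finset.sum_comm (f := fun i j => y j (q j (y i (q i w))))]
  abel

end FermionOperators

/-! ### Hard Lefschetz from the `sl₂` relation -/

section GradedPieces

variable {K M : Type*} [Field K] [AddCommGroup M] [Module K M]

variable {A : ℕ → Submodule K M} {L Λ : M →ₗ[K] M} {n : ℕ}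

/-- The case `c = 0` is injectivity of `L` below the middle; general `c` makes the induction close.
The relation gives `LΛ z = -(c + n - k) z`, so `Λ z` satisfies the same hypothesis two degrees lower
and vanishes; then `c + n - k > 0` kills `z`. -/
theorem eq_zero_of_lowering_raising_eq_neg_smul [CharZero K]
    (hΛ : ∀ k, ∀ z ∈ A (k + 2), Λ z ∈ A k) (hΛ0 : ∀ k < 2, ∀ z ∈ A k, Λ z = 0)
    (hrel : ∀ k, ∀ z ∈ A k, Λ (L z) = L (Λ z) + ((n : K) - k) • z) {k : ℕ} (hk : k < n)
    (c : ℕ) {z : M} (hz : z ∈ A k) (h : Λ (L z) = -(c : K) • z) : z = 0 := by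
  induction k using Nat.strong_induction_on generalizing c z with
  | _ k ih =>
    have h1 : L (Λ z) = -((c + (n - k) : ℕ) : K) • z := by
      have := hrel k z hz
      rw [h] at this
      push_cast [Nat.cast_sub hk.le]
      linear_combination (norm := module) (-1 : K) • this
    have h2 : Λ z = 0 := by
      rcases lt_or_ge k 2 with hk2 | hk2
      · exact hΛ0 k hk2 z hz
      · obtain ⟨l, rfl⟩ := Nat.exists_eq_add_of_le' hk2
        refine ih l (by omega) (by omega) (c + (n - (l + 2))) (hΛ l z hz) ?_
        rw [h1, map_smul]
    rw [h2, map_zero] at h1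
    have h3 : ((c + (n - k) : ℕ) : K) ≠ 0 := Nat.cast_ne_zero.2 (by omega)
    exact (smul_eq_zero.1 h1.symm).resolve_left (neg_ne_zero.2 h3)

/-- The mirror image above the middle, by induction downward from the top degree `m`. -/
theorem eq_zero_of_raising_lowering_eq_neg_smul [CharZero K] {m : ℕ}
    (hL : ∀ k, ∀ z ∈ A k, L z ∈ A (k + 2)) (hA : ∀ k, m < k → A k = ⊥)
    (hrel : ∀ k, ∀ z ∈ A k, Λ (L z) = L (Λ z) + ((n : K) - k) • z) {k : ℕ} (hk : n < k)
    (c : ℕ) {z : M} (hz : z ∈ A k) (h : L (Λ z) = -(c : K) • z) : z = 0 := by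
  induction hd : m + 1 - k using Nat.strong_induction_on generalizing c z k with
  | _ d ih =>
    rcases lt_or_ge m k with hmk | hmk
    · rw [hA k hmk] at hz
      exact (Submodule.mem_bot K).1 hz
    · have h1 : Λ (L z) = -((c + (k - n) : ℕ) : K) • z := by
        have := hrel k z hz
        rw [h] at this
        push_cast [Nat.cast_sub hk.le]
        linear_combination (norm := module) this
      have h2 : L z = 0 :=
        ih (m + 1 - (k + 2)) (by omega) (by omega) (c + (k - n)) (hL k z hz)
          (by rw [h1, map_smul]) rfl
      rw [h2, map_zero] at h1
      have h3 : ((c + (k - n) : ℕ) : K) ≠ 0 := Nat.cast_ne_zero.2 (by omega)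
      exact (smul_eq_zero.1 h1.symm).resolve_left (neg_ne_zero.2 h3)

open DirectSum in
theorem decompose_map_of_graded [Decomposition A] {T : M →ₗ[K] M} {d : ℕ}
    (hT : ∀ k, ∀ z ∈ A k, T z ∈ A (k + d)) (z : M) (k : ℕ) :
    (decompose A (T z) (k + d) : M) = T (decompose A z k) := by
  induction z using Decomposition.inductionOn A with
  | zero => simp
  | homogeneous z =>
    rename_i i
    by_cases h : i = k
    · subst h
      rw [decompose_of_mem_same A z.2, decompose_of_mem_same A (hT i z z.2)]
    · rw [decompose_of_mem_ne A z.2 h, decompose_of_mem_ne A (hT i z z.2) (by omega), map_zero]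
  | add x y hx hy => simp [decompose_add, hx, hy]

open DirectSum in
theorem sum_range_decompose [Decomposition A] {m : ℕ} (hA : ∀ k, m ≤ k → A k = ⊥) (z : M) :
    ∑ k ∈ Finset.range m, (decompose A z k : M) = z := by
  classical
  conv_rhs => rw [← sum_support_decompose A z]
  symm
  refine Finset.sum_subset (fun k hk => ?_) fun k _ hk => ?_
  · rw [Finset.mem_range]
    by_contra hmk
    have h1 : (decompose A z k : M) ∈ (⊥ : Submodule K M) :=
      hA k (not_lt.1 hmk) ▸ (decompose A z k).2
    exact DFinsupp.mem_support_iff.1 hk (Subtype.ext ((Submodule.mem_bot K).1 h1))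
  · rw [DFinsupp.notMem_support_iff.1 hk]
    rfl

open DirectSum in
theorem finrank_ker_of_graded [FiniteDimensional K M] [Decomposition A] {d m : ℕ}
    (hL : ∀ k, ∀ z ∈ A k, L z ∈ A (k + d)) (hA : ∀ k, m ≤ k → A k = ⊥) :
    finrank K (LinearMap.ker L) =
      ∑ k ∈ Finset.range m, finrank K (LinearMap.ker (L.domRestrict (A k))) := by
  rw [← Fin.sum_univ_eq_sum_range (fun k => finrank K (LinearMap.ker (L.domRestrict (A k)))),
    ← finrank_pi_fintype K]
  let φ : (∀ k : Fin m, LinearMap.ker (L.domRestrict (A k))) →ₗ[K] M :=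
    ∑ k : Fin m, (A k).subtype ∘ₗ (LinearMap.ker (L.domRestrict (A k))).subtype ∘ₗ
      LinearMap.proj k
  have hφ : ∀ v, φ v = ∑ k : Fin m, ((v k : A k) : M) := fun v => by
    simp [φ, LinearMap.sum_apply]
  have hinj : Function.Injective φ := by
    rw [injective_iff_map_eq_zero]
    intro v hv
    ext j
    have h1 := congrArg (fun z => (decompose A z j : M)) hv
    simp only [hφ, decompose_sum, decompose_zero, DirectSum.sum_apply,
      AddSubmonoidClass.coe_finsetSum] at h1
    rw [Finset.sum_eq_single j] at h1
    · rw [decompose_of_mem_same A (v j : A j).2] at h1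
      exact h1
    · intro i _ hij
      exact decompose_of_mem_ne A (v i : A i).2 (fun h => hij (Fin.ext h))
    · simp
  have hrange : LinearMap.range φ = LinearMap.ker L := by
    apply le_antisymm
    · rintro _ ⟨v, rfl⟩
      rw [LinearMap.mem_ker, hφ, map_sum]
      exact Finset.sum_eq_zero fun k _ => (v k).2
    · intro z hz
      refine ⟨fun k => ⟨decompose A z k, ?_⟩, ?_⟩
      · rw [LinearMap.mem_ker, LinearMap.domRestrict_apply, ← decompose_map_of_graded hL,
          LinearMap.mem_ker.1 hz]
        simp
      · rw [hφ, Fin.sum_univ_eq_sum_range (fun k => (decompose A z k : M)),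
          sum_range_decompose hA]
  rw [← hrange, LinearMap.finrank_range_of_inj hinj]

/-- Hard Lefschetz for a raising operator `L` of degree two with a lowering operator `Λ`: the
cokernel of `L` is as large as the two middle graded pieces. -/
theorem finrank_quotient_range_of_lowering [CharZero K] [FiniteDimensional K M]
    [DirectSum.Decomposition A] {m : ℕ} (hL : ∀ k, ∀ z ∈ A k, L z ∈ A (k + 2)) (hΛ : ∀ k, ∀ z ∈ A (k + 2), Λ z ∈ A k)
    (hΛ0 : ∀ k < 2, ∀ z ∈ A k, Λ z = 0) (hA : ∀ k, m < k → A k = ⊥)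
    (hrel : ∀ k, ∀ z ∈ A k, Λ (L z) = L (Λ z) + ((n : K) - k) • z) :
    finrank K (M ⧸ LinearMap.range L) = finrank K (A n) + finrank K (A (n + 1)) := by
  have hker : finrank K (M ⧸ LinearMap.range L) = finrank K (LinearMap.ker L) := by
    have h1 := Submodule.finrank_quotient_add_finrank (LinearMap.range L)
    have h2 := LinearMap.finrank_range_add_finrank_ker L
    omega
  -- The bound `m + n + 1` is at least `n` and exceeds `m`, so the telescoping starts in range and
  -- its boundary terms vanish.
  rw [hker, finrank_ker_of_graded (m := m + n + 1) hL (fun k hk => hA k (by omega))]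
  have hlow : ∀ k < n, finrank K (LinearMap.ker (L.domRestrict (A k))) = 0 := by
    intro k hk
    rw [Submodule.finrank_eq_zero, LinearMap.ker_eq_bot']
    intro z hz
    apply Subtype.ext
    refine eq_zero_of_lowering_raising_eq_neg_smul hΛ hΛ0 hrel hk 0 z.2 ?_
    have : L z = 0 := hz
    simp [this]
  have hhigh : ∀ k, n ≤ k → finrank K (LinearMap.ker (L.domRestrict (A k))) +
      finrank K (A (k + 2)) = finrank K (A k) := by
    intro k hk
    have hr : LinearMap.range (L.domRestrict (A k)) = A (k + 2) := by
      apply le_antisymm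
      · rintro _ ⟨z, rfl⟩
        exact hL k z z.2
      · intro z hz
        -- `LΛ` is injective on the finite-dimensional piece `A (k + 2)`, hence surjective, so `L`
        -- reaches all of it.
        have hmaps : ∀ z ∈ A (k + 2), (L ∘ₗ Λ) z ∈ A (k + 2) := fun z hz => hL k _ (hΛ k z hz)
        have hinj : Function.Injective ((L ∘ₗ Λ).restrict hmaps) := by
          rw [injective_iff_map_eq_zero]
          intro u hu
          apply Subtype.ext
          refine eq_zero_of_raising_lowering_eq_neg_smul hL hA hrel (by omega : n < k + 2) 0 u.2 ?_
          have : L (Λ u) = 0 := congrArg Subtype.val hu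
          simp [this]
        obtain ⟨u, hu⟩ := LinearMap.injective_iff_surjective.1 hinj ⟨z, hz⟩
        exact ⟨⟨Λ u, hΛ k u u.2⟩, congrArg Subtype.val hu⟩
    have h1 := LinearMap.finrank_range_add_finrank_ker (L.domRestrict (A k))
    rw [hr] at h1
    omega
  -- By `hhigh` the kernel in degree `k ≥ n` has dimension `dim A k - dim A (k + 2)`; the sum
  -- telescopes with two boundary terms.
  have key : ∀ j, n ≤ j → ∑ k ∈ Finset.range j, finrank K (LinearMap.ker (L.domRestrict (A k))) +
      finrank K (A j) + finrank K (A (j + 1)) = finrank K (A n) + finrank K (A (n + 1)) := by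
    intro j hj
    induction j, hj using Nat.le_induction with
    | base => rw [Finset.sum_eq_zero fun k hk => hlow k (Finset.mem_range.1 hk), zero_add]
    | succ j hj ih =>
      have := hhigh j hj
      rw [Finset.sum_range_succ, ← ih, show j + 1 + 1 = j + 2 from rfl]
      omega
  have h0 := key (m + n + 1) (by omega)
  rwa [hA (m + n + 1) (by omega), hA (m + n + 1 + 1) (by omega), finrank_bot, add_zero,
    add_zero] at h0

end GradedPieces

/-! ### Degrees of the operators -/

section Degree

variable {R E : Type*} [CommRing R] [AddCommGroup E] [Module R E]

theorem mul_ι_induction {k : ℕ} {C : ExteriorAlgebra R E → Prop}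
    (hmul : ∀ e, ∀ z ∈ ⋀[R]^k E, C (ExteriorAlgebra.ι R e * z))
    (hadd : ∀ z z', C z → C z' → C (z + z')) {z : ExteriorAlgebra R E} (hz : z ∈ ⋀[R]^(k + 1) E) :
    C z := by
  rw [ExteriorAlgebra.exteriorPower, pow_succ'] at hz
  refine Submodule.mul_induction_on hz ?_ hadd
  rintro _ ⟨e, rfl⟩ z hz
  exact hmul e z hz

theorem wedgeOp_mem {k : ℕ} (e : E) {z : ExteriorAlgebra R E} (hz : z ∈ ⋀[R]^k E) :
    wedgeOp e z ∈ ⋀[R]^(k + 1) E := by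
  rw [ExteriorAlgebra.exteriorPower, pow_succ', wedgeOp_apply]
  exact Submodule.mul_mem_mul ⟨e, rfl⟩ hz

theorem contractOp_eq_zero (d : Dual R E) {z : ExteriorAlgebra R E} (hz : z ∈ ⋀[R]^0 E) :
    contractOp d z = 0 := by
  rw [ExteriorAlgebra.exteriorPower, pow_zero] at hz
  obtain ⟨r, rfl⟩ := Submodule.mem_one.1 hz
  rw [Algebra.algebraMap_eq_smul_one, map_smul, contractOp_one, smul_zero]

theorem contractOp_mem (d : Dual R E) {k : ℕ} {z : ExteriorAlgebra R E}
    (hz : z ∈ ⋀[R]^(k + 1) E) : contractOp d z ∈ ⋀[R]^k E := by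
  induction k generalizing z with
  | zero =>
    refine mul_ι_induction (C := fun z => contractOp d z ∈ ⋀[R]^_ E)
      (fun e z hz => ?_) (fun z z' h h' => ?_) hz
    · rw [contractOp_ι_mul, contractOp_eq_zero d hz, mul_zero, sub_zero]
      exact Submodule.smul_mem _ _ hz
    · rw [map_add]
      exact Submodule.add_mem _ h h'
  | succ k ih =>
    refine mul_ι_induction (C := fun z => contractOp d z ∈ ⋀[R]^_ E)
      (fun e z hz => ?_) (fun z z' h h' => ?_) hz
    · rw [contractOp_ι_mul]
      exact Submodule.sub_mem _ (Submodule.smul_mem _ _ hz) (wedgeOp_mem e (ih hz))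
    · rw [map_add]
      exact Submodule.add_mem _ h h'

theorem rankOneOp_mem (e : E) (d : Dual R E) {k : ℕ} {z : ExteriorAlgebra R E}
    (hz : z ∈ ⋀[R]^k E) : rankOneOp e d z ∈ ⋀[R]^k E := by
  cases k with
  | zero =>
    rw [rankOneOp, Module.End.mul_apply, contractOp_eq_zero d hz, map_zero]
    exact Submodule.zero_mem _
  | succ k => exact wedgeOp_mem e (contractOp_mem d hz)

end Degree

/-! ### The canonical element and its lowering operator -/

section CanonicalElement

variable {V : Type*} [AddCommGroup V] [Module ℂ V] {ι : Type*} (b : Basis ι ℂ V)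

/-- The canonical element of `V ⊗ V*` in `∧²(V ⊕ V*)`. -/
noncomputable def canonicalElement [Fintype ι] : DoubleExterior V :=
  ∑ i, ExteriorAlgebra.ι ℂ ((b i, 0) : V × Dual ℂ V) * ExteriorAlgebra.ι ℂ (0, b.coord i)

/-- The lowering operator that is dual to multiplication by the canonical element. -/
noncomputable def loweringOp [Fintype ι] : DoubleExterior V →ₗ[ℂ] DoubleExterior V :=
  ∑ i, contractOp (dualInr (b i)) ∘ₗ contractOp (dualInl (b.coord i))

theorem canonicalElement_mul [Fintype ι] (z : DoubleExterior V) : canonicalElement b * z =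
    ∑ i, wedgeOp ((b i, 0) : V × Dual ℂ V) (wedgeOp (0, b.coord i) z) := by
  simp only [canonicalElement, Finset.sum_mul, mul_assoc, wedgeOp_apply]

theorem loweringOp_apply [Fintype ι] (z : DoubleExterior V) : loweringOp b z =
    ∑ i, contractOp (dualInr (b i)) (contractOp (dualInl (b.coord i)) z) := by
  simp only [loweringOp, LinearMap.sum_apply, LinearMap.comp_apply]

theorem isFermionSystem_basis [DecidableEq ι] : IsFermionSystem (K := ℂ) (M := DoubleExterior V)
    (fun i => wedgeOp (b i, 0)) (fun i => wedgeOp (0, b.coord i))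
    (fun i => contractOp (dualInl (b.coord i))) (fun i => contractOp (dualInr (b i))) where
  x_y i j z := LinearMap.congr_fun (wedgeOp_mul_wedgeOp _ _) z
  y_y i j z := LinearMap.congr_fun (wedgeOp_mul_wedgeOp _ _) z
  p_x i j z := by
    rw [wedgeOp_apply, contractOp_ι_mul, wedgeOp_apply]
    congr 1
    simp [Finsupp.single_apply, eq_comm]
  p_y i j z := by rw [wedgeOp_apply, contractOp_ι_mul, wedgeOp_apply]; simp
  q_x i j z := by rw [wedgeOp_apply, contractOp_ι_mul, wedgeOp_apply]; simp
  q_y i j z := by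
    rw [wedgeOp_apply, contractOp_ι_mul, wedgeOp_apply]
    congr 1
    simp [Finsupp.single_apply]

/-- The left side is a derivation that is the identity on generators, by the expansion of a vector
in the two dual bases; so it multiplies by the degree. -/
theorem number_eq_smul [Fintype ι] [DecidableEq ι] {k : ℕ} {z : DoubleExterior V}
    (hz : z ∈ ⋀[ℂ]^k (V × Dual ℂ V)) :
    ∑ i, rankOneOp (b i, 0) (dualInl (b.coord i)) z +
      ∑ i, rankOneOp (0, b.coord i) (dualInr (b i)) z = (k : ℂ) • z := by
  induction k generalizing z with
  | zero =>
    simp only [rankOneOp, Module.End.mul_apply, contractOp_eq_zero _ hz, map_zero,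
      Finset.sum_const_zero, Nat.cast_zero, zero_smul, add_zero]
  | succ k ih =>
    refine mul_ι_induction (C := fun z => ∑ i, rankOneOp (b i, 0) (dualInl (b.coord i)) z +
      ∑ i, rankOneOp (0, b.coord i) (dualInr (b i)) z = ((k + 1 : ℕ) : ℂ) • z)
      (fun e z hz => ?_) (fun z z' h h' => ?_) hz
    · have key : ∀ (u : V × Dual ℂ V) (d : Dual ℂ (V × Dual ℂ V)),
          rankOneOp u d (ExteriorAlgebra.ι ℂ e * z) =
            ExteriorAlgebra.ι ℂ (d e • u) * z + ExteriorAlgebra.ι ℂ e * rankOneOp u d z := by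
        intro u d
        have h := LinearMap.congr_fun (wedgeOp_mul_wedgeOp (R := ℂ) u e) (contractOp d z)
        simp only [LinearMap.neg_apply, Module.End.mul_apply, wedgeOp_apply] at h
        simp only [rankOneOp, Module.End.mul_apply, contractOp_ι_mul, map_sub, map_smul,
          wedgeOp_apply, h, smul_mul_assoc]
        abel
      simp only [key, Finset.sum_add_distrib, ← Finset.sum_mul, ← Finset.mul_sum, ← map_sum]
      have he : ∑ i, dualInl (b.coord i) e • ((b i, 0) : V × Dual ℂ V) +
          ∑ i, dualInr (b i) e • ((0, b.coord i) : V × Dual ℂ V) = e := by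
        refine Prod.ext ?_ (b.ext fun j => ?_)
        · simp [Prod.fst_sum, b.sum_repr]
        · simp [Prod.snd_sum]
      have h1 := congrArg (fun u => ExteriorAlgebra.ι ℂ u * z) he
      simp only [map_add, add_mul] at h1
      have h2 := congrArg (fun u => ExteriorAlgebra.ι ℂ e * u) (ih hz)
      simp only [mul_add, mul_smul_comm] at h2
      push_cast
      linear_combination (norm := module) h1 + h2
    · simp only [map_add, Finset.sum_add_distrib, smul_add, ← h, ← h']
      abel

theorem loweringOp_canonicalElement_mul [Fintype ι] [DecidableEq ι] {k : ℕ} {z : DoubleExterior V}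
    (hz : z ∈ ⋀[ℂ]^k (V × Dual ℂ V)) : loweringOp b (canonicalElement b * z) =
      canonicalElement b * loweringOp b z + ((Fintype.card ι : ℂ) - k) • z := by
  have h := (isFermionSystem_basis b).lowering_raising z
  rw [canonicalElement_mul, canonicalElement_mul, loweringOp_apply, loweringOp_apply, h, sub_smul,
    ← number_eq_smul b hz]
  rfl

/-- An element of positive degree annihilated by `gl(V)` is a multiple of the canonical element. -/
theorem exists_canonicalElement_mul_eq [Fintype ι] [DecidableEq ι] {k : ℕ} (hk : k ≠ 0)
    (hk' : k ≤ 2 * Fintype.card ι)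
    {w : DoubleExterior V} (hw : w ∈ ⋀[ℂ]^k (V × Dual ℂ V)) (hgl : ∀ a f, glOp a f w = 0) :
    ∃ z, canonicalElement b * z = w := by
  have hxy : ∀ i j, rankOneOp ((b i, 0) : V × Dual ℂ V) (dualInl (b.coord j)) w =
      rankOneOp (0, b.coord j) (dualInr (b i)) w := fun i j => sub_eq_zero.1 (hgl (b i) (b.coord j))
  have h := (isFermionSystem_basis b).raising_lowering hxy
  have hN := number_eq_smul b hw
  simp only [hxy] at hN
  -- Invariance equates the number operators of `V` and `V*`, so each is half of the degree.
  have hN' : ∑ i, rankOneOp (0, b.coord i) (dualInr (b i)) w = ((k : ℂ) / 2) • w := by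
    linear_combination (norm := module) (1 / 2 : ℂ) • hN
  have h1 : canonicalElement b * loweringOp b w =
      (((k : ℂ) / 2) * ((Fintype.card ι : ℂ) + 1 - (k : ℂ) / 2)) • w := by
    rw [canonicalElement_mul, loweringOp_apply]
    refine h.trans ?_
    change ((Fintype.card ι : ℂ) + 1) • (∑ i, rankOneOp (0, b.coord i) (dualInr (b i)) w) -
      ∑ j, rankOneOp (0, b.coord j) (dualInr (b j))
        (∑ i, rankOneOp (0, b.coord i) (dualInr (b i)) w) = _
    rw [hN']
    simp only [map_smul]
    rw [← Finset.smul_sum, hN']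
    module
  -- The second factor vanishes only at `k = 2(n + 1)`, beyond the top degree `2n`. Odd degrees need
  -- no separate treatment.
  have hne : ((k : ℂ) / 2) * ((Fintype.card ι : ℂ) + 1 - (k : ℂ) / 2) ≠ 0 := by
    refine mul_ne_zero (div_ne_zero (Nat.cast_ne_zero.2 hk) two_ne_zero) ?_
    intro h0
    have h3 : (k : ℂ) = ((2 * (Fintype.card ι + 1) : ℕ) : ℂ) := by
      push_cast
      linear_combination (-2 : ℂ) * h0
    have := Nat.cast_injective h3
    omega
  refine ⟨(((k : ℂ) / 2) * ((Fintype.card ι : ℂ) + 1 - (k : ℂ) / 2))⁻¹ • loweringOp b w, ?_⟩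
  rw [mul_smul_comm, h1, inv_smul_smul₀ hne]

theorem canonicalElement_commute [Fintype ι] (z : DoubleExterior V) :
    z * canonicalElement b = canonicalElement b * z := by
  have hι : ∀ e : V × Dual ℂ V,
      ExteriorAlgebra.ι ℂ e * canonicalElement b = canonicalElement b * ExteriorAlgebra.ι ℂ e := by
    intro e
    have hs : ∀ u : V × Dual ℂ V, ExteriorAlgebra.ι ℂ e * ExteriorAlgebra.ι ℂ u =
        -(ExteriorAlgebra.ι ℂ u * ExteriorAlgebra.ι ℂ e) := fun u =>
      eq_neg_of_add_eq_zero_left (ExteriorAlgebra.ι_add_mul_swap e u)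
    rw [canonicalElement, Finset.mul_sum, Finset.sum_mul]
    refine Finset.sum_congr rfl fun i _ => ?_
    rw [← mul_assoc, hs, neg_mul, mul_assoc, hs, mul_neg, neg_neg, mul_assoc]
  induction z using CliffordAlgebra.left_induction with
  | algebraMap r => exact Algebra.commutes r _
  | add x y hx hy => rw [add_mul, mul_add, hx, hy]
  | ι_mul z e hz => rw [mul_assoc, hz, ← mul_assoc, ← mul_assoc]; exact congrArg (· * z) (hι e)

/-- The canonical element corresponds to the identity in `V ⊗ V* = End V`, which conjugation fixes.
-/
theorem map_doubleAction_canonicalElement [Fintype ι] [DecidableEq ι] (w : V ≃ₗ[ℂ] V) :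
    ExteriorAlgebra.map (doubleAction w) (canonicalElement b) = canonicalElement b := by
  have hcoord : ∀ i, (b.coord i) ∘ₗ (w.symm : V →ₗ[ℂ] V) =
      ∑ j, b.coord i (w.symm (b j)) • b.coord j := by
    intro i
    refine b.ext fun j => ?_
    simp [LinearMap.sum_apply, Finsupp.single_apply]
  have h1 : ∀ i, doubleAction w (b i, 0) = LinearMap.inl ℂ V (Dual ℂ V) (w (b i)) := fun i => by
    simp [doubleAction]
  have h2 : ∀ i, doubleAction w (0, b.coord i) = LinearMap.inr ℂ V (Dual ℂ V)
      (∑ j, b.coord i (w.symm (b j)) • b.coord j) := fun i => by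
    rw [← hcoord]
    simp [doubleAction, LinearMap.dualMap_apply']
  simp only [canonicalElement, map_sum, map_mul, ExteriorAlgebra.map_apply_ι, h1, h2, map_smul,
    Finset.mul_sum, mul_smul_comm]
  rw [Finset.sum_comm]
  refine Finset.sum_congr rfl fun j _ => ?_
  simp only [← smul_mul_assoc, ← Finset.sum_mul, ← map_smul, ← map_sum, Basis.coord_apply,
    b.sum_repr, LinearEquiv.apply_symm_apply]
  rfl

end CanonicalElement

/-! ### The ideal of invariants and the dimension of its quotient -/

section FermionicQuotient

variable {V : Type*} [AddCommGroup V] [Module ℂ V] [FiniteDimensional ℂ V]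

theorem exteriorPower_eq_bot_of_finrank_lt {E : Type*} [AddCommGroup E] [Module ℂ E]
    [FiniteDimensional ℂ E] {k : ℕ} (hk : finrank ℂ E < k) : ⋀[ℂ]^k E = ⊥ := by
  rw [← Submodule.finrank_eq_zero, exteriorPower.finrank_eq, Nat.choose_eq_zero_of_lt hk]

theorem finrank_prod_dual : finrank ℂ (V × Dual ℂ V) = 2 * finrank ℂ V := by
  rw [finrank_prod, Subspace.dual_finrank_eq, two_mul]

open DirectSum in
-- The derivations `glOp a f` preserve degree, so each homogeneous component is annihilated
-- separately. The degree zero component is the constant term, since multiples of the canonical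
-- element have none.
theorem mem_range_mulLeft_canonicalElement {ι : Type*} [Fintype ι] [DecidableEq ι]
    (b : Basis ι ℂ V) {w : DoubleExterior V} (hw : ExteriorAlgebra.algebraMapInv w = 0)
    (hgl : ∀ a f, glOp a f w = 0) :
    w ∈ LinearMap.range (LinearMap.mulLeft ℂ (canonicalElement b)) := by
  let A : ℕ → Submodule ℂ (DoubleExterior V) := fun k => ⋀[ℂ]^k (V × Dual ℂ V)
  have hcard : finrank ℂ V = Fintype.card ι := finrank_eq_card_basis b
  have hA : ∀ k, 2 * Fintype.card ι + 1 ≤ k → A k = ⊥ := fun k hk =>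
    exteriorPower_eq_bot_of_finrank_lt (by rw [finrank_prod_dual]; omega)
  have hpos : ∀ k, k ≠ 0 → (decompose A w k : DoubleExterior V) ∈
      LinearMap.range (LinearMap.mulLeft ℂ (canonicalElement b)) := by
    intro k hk
    by_cases hk' : k ≤ 2 * Fintype.card ι
    · refine exists_canonicalElement_mul_eq b hk hk' (decompose A w k).2 fun a f => ?_
      rw [← decompose_map_of_graded (A := A) (d := 0) (fun k z hz =>
        Submodule.sub_mem _ (rankOneOp_mem _ _ hz) (rankOneOp_mem _ _ hz)), hgl]
      simp
    · have h1 : (decompose A w k : DoubleExterior V) ∈ (⊥ : Submodule ℂ (DoubleExterior V)) :=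
        hA k (by omega) ▸ (decompose A w k).2
      rw [(Submodule.mem_bot ℂ).1 h1]
      exact Submodule.zero_mem _
  have hinv : ∀ z ∈ LinearMap.range (LinearMap.mulLeft ℂ (canonicalElement b)),
      ExteriorAlgebra.algebraMapInv z = 0 := by
    rintro _ ⟨z, rfl⟩
    rw [LinearMap.mulLeft_apply, map_mul]
    simp [canonicalElement, ExteriorAlgebra.algebraMapInv]
  have hzero : (decompose A w 0 : DoubleExterior V) = 0 := by
    have hsum := sum_range_decompose hA w
    rw [Finset.sum_range_succ'] at hsum
    have h1 := congrArg ExteriorAlgebra.algebraMapInv hsum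
    rw [map_add, map_sum, Finset.sum_eq_zero fun k _ => hinv _ (hpos (k + 1) k.succ_ne_zero),
      zero_add, hw] at h1
    have h2 : (decompose A w 0 : DoubleExterior V) ∈ (1 : Submodule ℂ (DoubleExterior V)) := by
      rw [← pow_zero (LinearMap.range (ExteriorAlgebra.ι ℂ : V × Dual ℂ V →ₗ[ℂ] _))]
      exact (decompose A w 0).2
    obtain ⟨r, hr⟩ := Submodule.mem_one.1 h2
    rw [← hr, ExteriorAlgebra.algebraMap_leftInverse] at h1
    rw [← hr, h1, map_zero]
  rw [← sum_range_decompose hA w]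
  refine Submodule.sum_mem _ fun k _ => ?_
  by_cases hk : k = 0
  · rw [hk, hzero]
    exact Submodule.zero_mem _
  · exact hpos k hk

theorem mem_span_positiveInvariants_iff {ι : Type*} [Fintype ι] [DecidableEq ι] (b : Basis ι ℂ V)
    {W : Subgroup (V ≃ₗ[ℂ] V)} (hW : IsIrreducibleReflectionGroup W)
    (h1 : finrank ℂ V = 1 → W ≠ ⊥) (w : DoubleExterior V) :
    w ∈ TwoSidedIdeal.span (positiveInvariants W) ↔
      w ∈ LinearMap.range (LinearMap.mulLeft ℂ (canonicalElement b)) := by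
  constructor
  · intro hw
    rw [TwoSidedIdeal.mem_span_iff] at hw
    -- Centrality of the canonical element makes its left multiples a two-sided ideal, which can be
    -- tested against the span.
    have := hw (TwoSidedIdeal.mk' (LinearMap.range (LinearMap.mulLeft ℂ (canonicalElement b)))
      (Submodule.zero_mem _) (Submodule.add_mem _) (Submodule.neg_mem _)
      (by
        rintro x _ ⟨z, rfl⟩
        refine ⟨x * z, ?_⟩
        rw [LinearMap.mulLeft_apply, LinearMap.mulLeft_apply, ← mul_assoc, ← mul_assoc,
          canonicalElement_commute])
      (by
        rintro _ y ⟨z, rfl⟩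
        exact ⟨z * y, (mul_assoc _ _ _).symm⟩)) (by
        intro x hx
        rw [TwoSidedIdeal.coe_mk']
        exact mem_range_mulLeft_canonicalElement b hx.2
          (glOp_apply_eq_zero_of_invariant hW h1 hx.1))
    rwa [TwoSidedIdeal.mem_mk'] at this
  · rintro ⟨z, rfl⟩
    refine TwoSidedIdeal.mul_mem_right _ _ _ (TwoSidedIdeal.subset_span ⟨fun w _ =>
      map_doubleAction_canonicalElement b w, ?_⟩)
    simp [canonicalElement, ExteriorAlgebra.algebraMapInv]

theorem finrank_quotient_range_canonicalElement {ι : Type*} [Fintype ι] [DecidableEq ι]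
    (b : Basis ι ℂ V) :
    finrank ℂ (DoubleExterior V ⧸ LinearMap.range (LinearMap.mulLeft ℂ (canonicalElement b))) =
      (2 * Fintype.card ι + 1).choose (Fintype.card ι) := by
  have hdim : finrank ℂ (V × Dual ℂ V) = 2 * Fintype.card ι := by
    rw [finrank_prod_dual, finrank_eq_card_basis b]
  let A : ℕ → Submodule ℂ (DoubleExterior V) := fun k => ⋀[ℂ]^k (V × Dual ℂ V)
  have hA : ∀ k, 2 * Fintype.card ι < k → A k = ⊥ := fun k hk =>
    exteriorPower_eq_bot_of_finrank_lt (hdim ▸ hk)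
  have hfin : FiniteDimensional ℂ (DoubleExterior V) := by
    have htop : (⊤ : Submodule ℂ (DoubleExterior V)) =
        ⨆ k : Fin (2 * Fintype.card ι + 1), A k := by
      refine (eq_top_iff.2 fun z _ => ?_).symm
      rw [← sum_range_decompose hA z]
      exact Submodule.sum_mem _ fun k hk => Submodule.mem_iSup_of_mem ⟨k, Finset.mem_range.1 hk⟩
        (DirectSum.decompose A z k).2
    exact Module.Finite.of_surjective (⊤ : Submodule ℂ (DoubleExterior V)).subtype
      (fun z => ⟨⟨z, trivial⟩, rfl⟩) (hM := by rw [htop]; infer_instance)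
  rw [finrank_quotient_range_of_lowering (A := A)
    (Λ := loweringOp b) (n := Fintype.card ι) (m := 2 * Fintype.card ι) ?_ ?_ ?_ hA
    (fun k z hz => loweringOp_canonicalElement_mul b hz)]
  -- Symmetry replaces `C(2n + 1, n)` by `C(2n + 1, n + 1)`, which Pascal's rule splits into the two
  -- middle dimensions.
  · rw [exteriorPower.finrank_eq, exteriorPower.finrank_eq, hdim, ← Nat.choose_symm_half,
      Nat.choose_succ_succ]
  · intro k z hz
    rw [LinearMap.mulLeft_apply, canonicalElement_mul]
    exact Submodule.sum_mem _ fun i _ => wedgeOp_mem _ (wedgeOp_mem _ hz)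
  · intro k z hz
    rw [loweringOp_apply]
    exact Submodule.sum_mem _ fun i _ => contractOp_mem _ (contractOp_mem _ hz)
  · intro k hk z hz
    rw [loweringOp_apply]
    refine Finset.sum_eq_zero fun i _ => ?_
    interval_cases k
    · rw [contractOp_eq_zero _ hz, map_zero]
    · exact contractOp_eq_zero _ (contractOp_mem _ hz)

end FermionicQuotient

theorem corollary4p4 {V : Type*} [AddCommGroup V] [Module ℂ V] [FiniteDimensional ℂ V]
    (W : Subgroup (V ≃ₗ[ℂ] V)) (hW : IsIrreducibleReflectionGroup W)
    (n : ℕ) (hn : Module.finrank ℂ V = n) (hW1 : n = 1 → W ≠ ⊥) :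
    Module.finrank ℂ (FermionicDR W) = (2 * n + 1).choose n := by
  subst hn
  let b := finBasis ℂ V
  have h := finrank_quotient_range_canonicalElement b
  rw [Fintype.card_fin] at h
  rw [← h]
  have hI : (TwoSidedIdeal.span (positiveInvariants W)).asIdeal.restrictScalars ℂ =
      LinearMap.range (LinearMap.mulLeft ℂ (canonicalElement b)) := by
    ext w
    rw [Submodule.restrictScalars_mem, TwoSidedIdeal.mem_asIdeal]
    exact mem_span_positiveInvariants_iff b hW hW1 w
  rw [← hI]
  exact (Submodule.Quotient.restrictScalarsEquiv ℂ
    (TwoSidedIdeal.span (positiveInvariants W)).asIdeal).symm.finrank_eq
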